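/- **Setting.** A network is a finite directed acyclic graph with edge set $\mathcal E$ and a finite set $\mathcal S$ of sources; source $s$ is available at the nodes of a set $a(s)$ and demanded at the nodes of a set $b(s)$, $a(s)\cap b(s)=\emptyset$. The sources are i.i.d. copies of a finite-valued random vector $(Y_s)_{s\in\mathcal S}$. For an edge $e$ write $f\to e$ if $f$ is an edge whose head is the tail of $e$, or a source available at the tail of $e$; for a node $u$ write $f\to u$ if the edge $f$ has head $u$. $H$ is Shannon entropy in bits. A polymatroid over a finite set $Z$ is a function $h:\mathcal P(Z)\to\mathbb R$ with $h(\emptyset)=0$ that is nonnegative, monotone and submodular; $h(\alpha\mid\beta)=h(\alpha\cup\beta)-h(\beta)$; $\Gamma$ is the set of all polymatroids. * $\mathcal R_{\rm cs}$ is the set of achievable capacity tuples $(C_e)_{e\in\mathcal E}\in\mathbb R^{\mathcal E}$: there are network codes of block length $N=1,2,\dots$ (a local encoding function with finite message alphabet $\mathcal U_e^{(N)}$ for each edge $e$, a decoding function for each source $s$ and each $u\in b(s)$) such that $\limsup_N \frac1N\log_2|\mathcal U^{(N)}_e|\le C_e$ for all $e$ and every decoding error probability tends to $0$. * $\mathcal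 R_{\rm cs}(\Gamma)$, the basic LP bound, is the set of tuples $(C_e)$ for which there is a polymatroid $h$ over $\mathcal S\cup\mathcal E$ with $h(\alpha)=H(Y_s,s\in\alpha)$ for all $\alpha\subseteq\mathcal S$, $h(e\mid f\in\mathcal S\cup\mathcal E: f\to e)=0$ and $h(e)\le C_e$ for all $e$, and $h(s\mid s'\in\mathcal S:u\in a(s'),\ f\in\mathcal E:f\to u)=0$ for all $s$ and all $u\in b(s)$. * Given auxiliary random variables $(K_i)_{i\in\mathcal L}$ jointly distributed with the sources, $\mathcal R^*_{\rm cs}(\Gamma)$, the improved LP bound, is defined in the same way with a polymatroid $h$ over $\mathcal S\cup\mathcal E\cup\mathcal L$, the first condition being replaced by $h(\alpha\cup\beta)=H(Y_s,s\in\alpha,\ K_i,i\in\beta)$ for all $\alpha\subseteq\mathcal S$, $\beta\subseteq\mathcal L$. **The example.** Let $b_0,b_1,b_2$ be independent uniform bits, $Y_1=(b_0,b_1)$, $Y_2=(b_0,b_2)$, $Y_3=(b_1,b_2)$. The network has nodes $1,\dots,5$, edges $e_1=(1,2)$, $e_2=(1,3)$, $e_3=(1,4)$, $e_4=(1,5)$,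 and three relay edges $(2,3),(2,4),(2,5)$; all sources are available at node $1$ only, and $Y_1,Y_2,Y_3$ are demanded at nodes $3,4,5$ respectively. Write a capacity tuple as $(C,D)$ with $C=(C_1,\dots,C_4)$ the capacities of $e_1,\dots,e_4$ and $D\in\mathbb R^3$ those of the relay edges. Let $\mathcal R^*_{\rm cs}(\Gamma)$ be formed with the auxiliary variables $K_i=b_i$, $i=0,1,2$. Then: 1. If all relay capacities are at least $C_1$, then $(C,D)\in\mathcal R^*_{\rm cs}(\Gamma)$ if and only if there is a polymatroid $h$ over $\{s_1,s_2,s_3,e_1,e_2,e_3,e_4,k_0,k_1,k_2\}$ with $h(s_i)=2$; $h(s_i,s_j)=3$ for $i\ne j$; $h(k_i,i\in\alpha)=|\alpha|$ for $\alpha\subseteq\{0,1,2\}$; $h(s_1|k_0,k_1)=h(s_2|k_0,k_2)=h(s_3|k_1,k_2)=0$; $h(k_0,k_1)=h(s_1)$, $h(k_0,k_2)=h(s_2)$, $h(k_1,k_2)=h(s_3)$; $h(e_i|s_1,s_2,s_3)=0$ for $i=1,\dots,4$; $h(s_1|e_1,e_2)=h(s_2|e_1,e_3)=h(s_3|e_1,e_4)=0$;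 and $h(e_i)\le C_i$ for $i=1,\dots,4$. 2. It is an outer bound for this network: $\mathcal R_{\rm cs}\subseteq\mathcal R^*_{\rm cs}(\Gamma)$. 3. The tuple $C=(1,1,1,1)$ lies in the basic bound: $((1,1,1,1),D)\in\mathcal R_{\rm cs}(\Gamma)$ whenever all relay capacities are at least $1$. 4. It is excluded by the improved bound and is not achievable: $((1,1,1,1),D)\notin\mathcal R^*_{\rm cs}(\Gamma)$ and $((1,1,1,1),D)\notin\mathcal R_{\rm cs}$ for every $D$. 5. The improved bound is strictly tighter: $\mathcal R^*_{\rm cs}(\Gamma)\subsetneq\mathcal R_{\rm cs}(\Gamma)$, and also, for every fixed $D$ with all entries at least $1$, $\{C:(C,D)\in\mathcal R^*_{\rm cs}(\Gamma)\}\subsetneq\{C:(C,D)\in\mathcal R_{\rm cs}(\Gamma)\}$. -/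

import Mathlib

open MeasureTheory ProbabilityTheory Filter Topology

noncomputable section

/-! ### Entropy of finite-valued random variables, polymatroids -/

/-- Shannon entropy (in bits) of a random variable with values in a finite set. -/
def shannonEntropy {Ω A : Type*} [MeasurableSpace Ω] [Finite A] (μ : Measure Ω) (X : Ω → A) : ℝ :=
  (∑ᶠ a : A, Real.negMulLog (μ.real (X ⁻¹' {a}))) / Real.log 2

/-- The random vector `(X_i, i ∈ α)`. -/
def subvector {Ω ι : Type*} {A : ι → Type*} (X : ∀ i, Ω → A i) (α : Set ι) :
    Ω → ∀ i : α, A i :=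
  fun ω i => X i ω

/-- A polymatroid over the ground set `Z`. -/
structure IsPolymatroid {Z : Type*} (h : Set Z → ℝ) : Prop where
  empty : h ∅ = 0
  nonneg : ∀ β, 0 ≤ h β
  mono : ∀ α β, β ⊆ α → h β ≤ h α
  submodular : ∀ α β, h (α ∩ β) + h (α ∪ β) ≤ h α + h β

/-- The set `Γ` of all polymatroids over `Z`. -/
def polymatroids (Z : Type*) : Set (Set Z → ℝ) := {h | IsPolymatroid h}

/-- `h(α | β) = h(α ∪ β) - h(β)`. -/
def condRank {Z : Type*} (h : Set Z → ℝ) (α β : Set Z) : ℝ := h (α ∪ β) - h β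

/-! ### Networks with correlated sources -/

/-- A directed acyclic network with nodes `V`, edges `E` (an edge `e` goes from `tail e` to
`head e`) and sources `S`. Source `s` is available at the nodes in `avail s` (the map `a`) and is
demanded by the nodes in `demand s` (the map `b`). -/
structure SourceNetwork (V E S : Type*) where
  tail : E → V
  head : E → V
  avail : S → Set V
  demand : S → Set V
  acyclic : ∀ e, ¬ Relation.TransGen (fun f g => head f = tail g) e e
  disjoint : ∀ s, Disjoint (avail s) (demand s)

namespace SourceNetwork

variable {V E S : Type*}

/-- The sources available at a node. -/
def sourcesAt (G : SourceNetwork V E S) (u : V) : Set S := {s | u ∈ G.avail s}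

/-- The edges entering a node. -/
def edgesInto (G : SourceNetwork V E S) (u : V) : Set E := {f | G.head f = u}

theorem wellFounded_edges [Finite E] (G : SourceNetwork V E S) :
    WellFounded (fun f e : E => f ∈ G.edgesInto (G.tail e)) := by
  have : Std.Irrefl (Relation.TransGen (fun f g => G.head f = G.tail g)) := ⟨G.acyclic⟩
  have hwf := Finite.wellFounded_of_trans_of_irrefl
    (Relation.TransGen (fun f g => G.head f = G.tail g))
  refine Subrelation.wf ?_ hwf
  intro f e hfe
  exact Relation.TransGen.single hfe

/-- A network code of block length `N` for source alphabets `Y s`: message alphabets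
`{0, …, size e - 1}`, a local encoding function for each edge, and a decoding function for each
source `s` and each node `u` which demands it. -/
structure Code (G : SourceNetwork V E S) (Y : S → Type*) (N : ℕ) where
  size : E → ℕ
  encode : ∀ e : E, (∀ s : G.sourcesAt (G.tail e), Fin N → Y s) →
    (∀ f : G.edgesInto (G.tail e), Fin (size f)) → Fin (size e)
  decode : ∀ (s : S) (u : V), u ∈ G.demand s → (∀ s' : G.sourcesAt u, Fin N → Y s') →
    (∀ f : G.edgesInto u, Fin (size f)) → (Fin N → Y s)

/-- The message `U_e` transmitted on edge `e` when the source blocks are `y`, obtained by applying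
the local encoding functions along the acyclic network. -/
def Code.message [Finite E] {G : SourceNetwork V E S} {Y : S → Type*} {N : ℕ} (c : G.Code Y N)
    (y : ∀ s, Fin N → Y s) (e : E) : Fin (c.size e) :=
  G.wellFounded_edges.fix (C := fun e => Fin (c.size e))
    (fun e prev => c.encode e (fun s => y s) (fun f => prev f f.2)) e

/-- The message on each edge is the local encoding function applied to the available sources and
the messages on the incoming edges. -/
theorem Code.message_eq [Finite E] {G : SourceNetwork V E S} {Y : S → Type*} {N : ℕ}
    (c : G.Code Y N) (y : ∀ s, Fin N → Y s) (e : E) :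
    c.message y e = c.encode e (fun s => y s) (fun f => c.message y f) :=
  G.wellFounded_edges.fix_eq (C := fun e => Fin (c.size e)) _ e

/-- The block which node `u` decodes for source `s` when the source blocks are `y`. -/
def Code.decoded [Finite E] {G : SourceNetwork V E S} {Y : S → Type*} {N : ℕ} (c : G.Code Y N)
    (y : ∀ s, Fin N → Y s) (s : S) (u : V) (hu : u ∈ G.demand s) : Fin N → Y s :=
  c.decode s u hu (fun s' => y s') (fun f => c.message y f)

/-- Probability that node `u` decodes source `s` incorrectly, the source blocks being `N`
independent copies of the source vector `X`; the copies live on the product space `Ω ^ N`. -/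
def Code.errorProb [Finite E] {G : SourceNetwork V E S} {Y : S → Type*} {N : ℕ} {Ω : Type*}
    [MeasurableSpace Ω] (μ : Measure Ω) (X : ∀ s, Ω → Y s) (c : G.Code Y N)
    (s : S) (u : V) (hu : u ∈ G.demand s) : ℝ :=
  (Measure.pi (fun _ : Fin N => μ)).real
    {ω | c.decoded (fun s' n => X s' (ω n)) s u hu ≠ fun n => X s (ω n)}

/-- The set `R_cs` of achievable link capacity tuples. The rate condition says that the upper limit
of `log₂ |U_e| / N` is at most `C e`, for every edge `e`. -/
def achievableRegion [Finite E] (G : SourceNetwork V E S) {Y : S → Type*} {Ω : Type*}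
    [MeasurableSpace Ω] (μ : Measure Ω) (X : ∀ s, Ω → Y s) : Set (E → ℝ) :=
  {C | ∃ c : ∀ N : ℕ, G.Code Y N,
    (∀ e, ∀ ε > 0, ∀ᶠ N : ℕ in atTop, Real.logb 2 ((c N).size e) / N ≤ C e + ε) ∧
    ∀ s u, ∀ hu : u ∈ G.demand s,
      Tendsto (fun N => (c N).errorProb μ X s u hu) atTop (𝓝 0)}

/-- The encoding, decoding and capacity constraints which the network imposes on a set function
`h` over a ground set `Z` that contains the sources (through `src`) and the edges (through `edg`):
`h(e | f ∈ S ∪ E : f → e) = 0`, `h(s | s' : u ∈ a(s'), f : f → u) = 0` and `h(e) ≤ C_e`. -/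
structure LinkConstraints (G : SourceNetwork V E S) {Z : Type*} (src : S → Z) (edg : E → Z)
    (h : Set Z → ℝ) (C : E → ℝ) : Prop where
  encoding : ∀ e, condRank h {edg e}
    (src '' G.sourcesAt (G.tail e) ∪ edg '' G.edgesInto (G.tail e)) = 0
  decoding : ∀ s, ∀ u ∈ G.demand s, condRank h {src s}
    (src '' G.sourcesAt u ∪ edg '' G.edgesInto u) = 0
  capacity : ∀ e, h {edg e} ≤ C e

/-- The bound `R_cs(Δ)`, for a set `Δ` of polymatroids over `S ∪ E`. -/
def outerRegion (G : SourceNetwork V E S) {Y : S → Type*} [Finite S] [∀ s, Finite (Y s)]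
    {Ω : Type*} [MeasurableSpace Ω] (μ : Measure Ω) (X : ∀ s, Ω → Y s)
    (Δ : Set (Set (S ⊕ E) → ℝ)) : Set (E → ℝ) :=
  {C | ∃ h ∈ Δ, (∀ α : Set S, h (Sum.inl '' α) - shannonEntropy μ (subvector X α) = 0) ∧
    G.LinkConstraints Sum.inl Sum.inr h C}

/-- The improved bound `R*_cs(Δ)` with auxiliary random variables `K_i`, `i ∈ L`, jointly
distributed with the sources, for a set `Δ` of polymatroids over `S ∪ E ∪ L`. -/
def improvedRegion (G : SourceNetwork V E S) {Y : S → Type*} [Finite S] [∀ s, Finite (Y s)]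
    {L : Type*} {A : L → Type*} [Finite L] [∀ i, Finite (A i)]
    {Ω : Type*} [MeasurableSpace Ω] (μ : Measure Ω) (X : ∀ s, Ω → Y s) (K : ∀ i, Ω → A i)
    (Δ : Set (Set (S ⊕ E ⊕ L) → ℝ)) : Set (E → ℝ) :=
  {C | ∃ h ∈ Δ,
    (∀ (α : Set S) (β : Set L),
      h (Sum.inl '' α ∪ (Sum.inr ∘ Sum.inr) '' β)
        - shannonEntropy μ (fun ω => (subvector X α ω, subvector K β ω)) = 0) ∧
    G.LinkConstraints Sum.inl (Sum.inr ∘ Sum.inl) h C}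

end SourceNetwork

/-! ### The example network

The nodes `1, …, 5` are `0, …, 4 : Fin 5`, the sources `1, 2, 3` are `0, 1, 2 : Fin 3`. The edge
`e_i` is `Sum.inl (i - 1)`: `e_1 = (1,2)`, `e_2 = (1,3)`, `e_3 = (1,4)`, `e_4 = (1,5)`. The edges
`Sum.inr j` are the three relay edges `(2,3)`, `(2,4)`, `(2,5)`. -/

def exampleTail : Fin 4 ⊕ Fin 3 → Fin 5 := Sum.elim ![0, 0, 0, 0] ![1, 1, 1]

def exampleHead : Fin 4 ⊕ Fin 3 → Fin 5 := Sum.elim ![1, 2, 3, 4] ![2, 3, 4]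

theorem exampleTail_lt_exampleHead : ∀ e, exampleTail e < exampleHead e := by decide

/-- All three sources are available at node `1`; source `i` is demanded at node `i + 2`. -/
def exampleNetwork : SourceNetwork (Fin 5) (Fin 4 ⊕ Fin 3) (Fin 3) where
  tail := exampleTail
  head := exampleHead
  avail := fun _ => {0}
  demand := fun s => {![2, 3, 4] s}
  acyclic := by
    have key : ∀ e f, Relation.TransGen (fun f g => exampleHead f = exampleTail g) e f →
        exampleTail e < exampleTail f := by
      intro e f hef
      induction hef with
      | single h => exact h ▸ exampleTail_lt_exampleHead _
      | tail _ h ih => exact ih.trans (h ▸ exampleTail_lt_exampleHead _)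
    exact fun e he => lt_irrefl _ (key e e he)
  disjoint := by
    intro s
    fin_cases s <;> simp

/-- `Y_1 = (b_0, b_1)`, `Y_2 = (b_0, b_2)`, `Y_3 = (b_1, b_2)`. -/
def exampleSources {Ω : Type*} (b : Fin 3 → Ω → Bool) : Fin 3 → Ω → Bool × Bool :=
  ![fun ω => (b 0 ω, b 1 ω), fun ω => (b 0 ω, b 2 ω), fun ω => (b 1 ω, b 2 ω)]

/-- Ground set `{s_1, s_2, s_3, e_1, e_2, e_3, e_4, k_0, k_1, k_2}`. -/
inductive ExampleVar
  /-- `s i` stands for `s_{i+1}`. -/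
  | s (i : Fin 3)
  /-- `e i` stands for `e_{i+1}`. -/
  | e (i : Fin 4)
  /-- `k i` stands for `k_i`. -/
  | k (i : Fin 3)

open ExampleVar in
/-- The explicit linear program in the variables `s_1, s_2, s_3, e_1, …, e_4, k_0, k_1, k_2`. -/
structure ExampleLP (h : Set ExampleVar → ℝ) (C : Fin 4 → ℝ) : Prop where
  polymatroid : h ∈ polymatroids ExampleVar
  source : ∀ i, h {s i} = 2
  source_pair : ∀ i j, i ≠ j → h {s i, s j} = 3
  aux : ∀ α : Set (Fin 3), h (k '' α) = α.ncard
  source_of_aux₁ : condRank h {s 0} {k 0, k 1} = 0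
  source_of_aux₂ : condRank h {s 1} {k 0, k 2} = 0
  source_of_aux₃ : condRank h {s 2} {k 1, k 2} = 0
  aux_pair₁ : h {k 0, k 1} = h {s 0}
  aux_pair₂ : h {k 0, k 2} = h {s 1}
  aux_pair₃ : h {k 1, k 2} = h {s 2}
  encoding : ∀ i, condRank h {e i} {s 0, s 1, s 2} = 0
  decoding₁ : condRank h {s 0} {e 0, e 1} = 0
  decoding₂ : condRank h {s 1} {e 0, e 2} = 0
  decoding₃ : condRank h {s 2} {e 0, e 3} = 0
  capacity : ∀ i, h {e i} ≤ C i

end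

noncomputable section

/-! ### Entropy of partitions of a finite set -/

section PartitionEntropy

variable {T : Type*} [Fintype T]

/-! All variables are functions of a uniform bit triple, so a random variable may be replaced by the
partition of a finite set into its fibres and entropy by an average of log class sizes. One
inequality of Gibbs type, `setoidEntropy_le_add_of_subprobability`, then yields submodularity, the
log-cardinality bound and Fano's inequality, each from a choice of subprobability weights.

Outer bound (`achievableRegion_subset_improvedRegion`): a code of block length `N` gives partitions
of the set of source blocks. Their joint entropies divided by `N` form a polymatroid with values in
a fixed compact interval, exact on sources and auxiliary variables. An ultrafilter limit along `N →
∞` exists by compactness; the polymatroid axioms are closed conditions, Fano makes the decoding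
defect vanish, and the rates pass to the limit.

Exclusion of (1,1,1,1) (`ExampleLP.false_of_capacity_one`): each source has rank 2 and is decoded
from the first link and one further link, of rank at most 1 each. So the first link is a function of
every source, hence of every pair of bits. Submodularity at the independent bits forces its rank to
be 0, and one link of rank 1 cannot carry a source of rank 2.

The basic bound misses this because it sees only the ranks 2, 3, 3 of one, two and three sources.
Four points in general position in rank 3 realise the same ranks with one point common to all
sources (`mem_outerRegion`), and the first link can carry that point. -/

open scoped Classical in
/-- The number of elements which are equivalent to `t`. -/
def classCard (r : Setoid T) (t : T) : ℕ := (Finset.univ.filter fun u => r t u).card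

theorem classCard_pos (r : Setoid T) (t : T) : 0 < classCard r t :=
  Finset.card_pos.2 ⟨t, by simp⟩

theorem classCard_cast_pos (r : Setoid T) (t : T) : (0 : ℝ) < classCard r t :=
  Nat.cast_pos.2 (classCard_pos r t)

theorem classCard_le_card (r : Setoid T) (t : T) : classCard r t ≤ Fintype.card T :=
  Finset.card_le_univ _

theorem classCard_mono {r s : Setoid T} (h : r ≤ s) (t : T) : classCard r t ≤ classCard s t := by
  classical
  exact Finset.card_le_card (Finset.monotone_filter_right _ fun _ _ hu => h hu)

theorem classCard_congr {r : Setoid T} {t u : T} (h : r t u) : classCard r t = classCard r u := by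
  unfold classCard
  congr 1
  ext v
  simp only [Finset.mem_filter, Finset.mem_univ, true_and]
  exact ⟨fun hv => r.trans' (r.symm' h) hv, fun hv => r.trans' h hv⟩

theorem classCard_top (t : T) : classCard (⊤ : Setoid T) t = Fintype.card T := by
  classical
  have : ∀ u, (⊤ : Setoid T) t u := fun _ => trivial
  simp [classCard, this]

/-- `P` lies inside a single class, so all terms are equal and the sum is the fraction of that class
which `P` fills. -/
theorem sum_inv_classCard_le_one (r : Setoid T) (P : Finset T)
    (hP : ∀ t ∈ P, ∀ u ∈ P, r t u) : ∑ t ∈ P, (1 : ℝ) / classCard r t ≤ 1 := by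
  classical
  obtain rfl | ⟨v, hv⟩ := P.eq_empty_or_nonempty
  · simp
  have h1 : ∑ t ∈ P, (1 : ℝ) / classCard r t = P.card * (1 / classCard r v) := by
    rw [← nsmul_eq_mul]
    exact Finset.sum_eq_card_nsmul fun t ht => by rw [classCard_congr (hP t ht v hv)]
  have h2 : P.card ≤ classCard r v :=
    Finset.card_le_card fun t ht => by simp [hP v hv t ht]
  rw [h1, mul_one_div, div_le_one (classCard_cast_pos r v)]
  exact_mod_cast h2

/-- Entropy (in bits) of the partition into the classes of `r`, for the uniform distribution. -/
def setoidEntropy (r : Setoid T) : ℝ :=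
  (∑ t, Real.logb 2 (Fintype.card T / classCard r t)) / Fintype.card T

theorem logb_card_div_nonneg (r : Setoid T) (t : T) :
    0 ≤ Real.logb 2 (Fintype.card T / classCard r t) := by
  refine Real.logb_nonneg one_lt_two ?_
  rw [one_le_div (classCard_cast_pos r t)]
  exact_mod_cast classCard_le_card r t

theorem setoidEntropy_nonneg (r : Setoid T) : 0 ≤ setoidEntropy r :=
  div_nonneg (Finset.sum_nonneg fun t _ => logb_card_div_nonneg r t) (Nat.cast_nonneg _)

theorem setoidEntropy_anti {r s : Setoid T} (h : r ≤ s) : setoidEntropy s ≤ setoidEntropy r := by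
  unfold setoidEntropy
  gcongr with t
  · norm_num
  · have : Nonempty T := ⟨t⟩
    exact div_pos (Nat.cast_pos.2 Fintype.card_pos) (classCard_cast_pos s t)
  · exact classCard_cast_pos r t
  · exact classCard_mono h t

theorem setoidEntropy_top : setoidEntropy (⊤ : Setoid T) = 0 := by
  unfold setoidEntropy
  rw [Finset.sum_eq_zero, zero_div]
  intro t _
  have : Nonempty T := ⟨t⟩
  rw [classCard_top, div_self (Nat.cast_ne_zero.2 Fintype.card_ne_zero), Real.logb_one]

theorem setoidEntropy_le_logb_card (r : Setoid T) :
    setoidEntropy r ≤ Real.logb 2 (Fintype.card T) := by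
  rcases isEmpty_or_nonempty T with hT | hT
  · simp [setoidEntropy]
  have hc : (0 : ℝ) < Fintype.card T := Nat.cast_pos.2 Fintype.card_pos
  unfold setoidEntropy
  rw [div_le_iff₀ hc, mul_comm, ← nsmul_eq_mul, ← Finset.card_univ]
  refine Finset.sum_le_card_nsmul _ _ _ fun t _ => ?_
  rw [Finset.card_univ]
  refine Real.logb_le_logb_of_le one_lt_two (div_pos hc (classCard_cast_pos r t)) ?_
  exact div_le_self hc.le (by exact_mod_cast classCard_pos r t)

open scoped Classical in
/-- Gibbs' inequality: the entropy of `r` given `s` is at most the expected code length of any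
subprobability assignment `q` on the classes of `r` within each class of `s`. -/
theorem setoidEntropy_le_add_of_subprobability (r s : Setoid T) (q : T → ℝ) (hq : ∀ t, 0 < q t)
    (hqs : ∀ v, ∑ t with s v t, q t / classCard r t ≤ 1) :
    setoidEntropy r ≤ setoidEntropy s + (∑ t, -Real.logb 2 (q t)) / Fintype.card T := by
  unfold setoidEntropy
  rw [← add_div, ← Finset.sum_add_distrib]
  refine div_le_div_of_nonneg_right ?_ (Nat.cast_nonneg _)
  have hlog2 : 0 < Real.log 2 := Real.log_pos one_lt_two
  -- This is `log x ≤ x - 1` at `x = q t * classCard s t / classCard r t`.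
  have key : ∀ t, Real.logb 2 (Fintype.card T / classCard r t)
      - (Real.logb 2 (Fintype.card T / classCard s t) + -Real.logb 2 (q t))
      ≤ (q t / classCard r t * classCard s t - 1) / Real.log 2 := by
    intro t
    have : Nonempty T := ⟨t⟩
    have hc : (0 : ℝ) < Fintype.card T := Nat.cast_pos.2 Fintype.card_pos
    have hr := classCard_cast_pos r t
    have hs := classCard_cast_pos s t
    have h := Real.log_le_sub_one_of_pos (mul_pos (div_pos (hq t) hr) hs)
    rw [Real.log_mul (div_pos (hq t) hr).ne' hs.ne', Real.log_div (hq t).ne' hr.ne'] at h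
    simp only [Real.logb]
    rw [Real.log_div hc.ne' hr.ne', Real.log_div hc.ne' hs.ne', ← sub_nonneg]
    have : ∀ a b c d e x : ℝ, (x - 1) / e - ((a - b) / e - ((a - c) / e + -(d / e)))
        = (x - 1 - (d - b + c)) / e := by intros; ring
    rw [this]
    exact div_nonneg (by linarith) hlog2.le
  have hsum := Finset.sum_le_sum fun t (_ : t ∈ Finset.univ) => key t
  -- Double counting: the factor `classCard s t` counts the `v` equivalent to `t`, and exchanging
  -- the sums leaves one subprobability sum per `v`.
  have htot : ∑ t, q t / classCard r t * classCard s t ≤ Fintype.card T := by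
    calc ∑ t, q t / classCard r t * classCard s t
        = ∑ t, ∑ v with s t v, q t / classCard r t := by
          simp [classCard, mul_comm]
      _ = ∑ v, ∑ t with s v t, q t / classCard r t := by
          simp only [Finset.sum_filter]
          rw [Finset.sum_comm]
          simp only [s.comm']
      _ ≤ ∑ _v : T, (1 : ℝ) := Finset.sum_le_sum fun v _ => hqs v
      _ = Fintype.card T := by simp
  rw [Finset.sum_sub_distrib, ← Finset.sum_div, Finset.sum_sub_distrib] at hsum
  have h0 : (∑ t, q t / classCard r t * classCard s t - ∑ _t : T, (1 : ℝ)) / Real.log 2 ≤ 0 := by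
    refine div_nonpos_of_nonpos_of_nonneg ?_ hlog2.le
    simpa using htot
  linarith

/-- Gibbs' inequality with weight the conditional probability of the `r`-class given the `q`-class,
whose expected code length is the entropy of `r` minus that of `q`. Any common coarsening `q` is
allowed: the partition of an intersection of index sets may be strictly coarser than the join. -/
theorem setoidEntropy_submodular {r s q : Setoid T} (hr : r ≤ q) (hs : s ≤ q) :
    setoidEntropy q + setoidEntropy (r ⊓ s) ≤ setoidEntropy r + setoidEntropy s := by
  classical
  have h := setoidEntropy_le_add_of_subprobability (r ⊓ s) s
    (fun t => classCard r t / classCard q t)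
    (fun t => div_pos (classCard_cast_pos r t) (classCard_cast_pos q t)) ?_
  · have : (∑ t, -Real.logb 2 ((classCard r t : ℝ) / classCard q t)) / Fintype.card T
        = setoidEntropy r - setoidEntropy q := by
      unfold setoidEntropy
      rw [← sub_div, ← Finset.sum_sub_distrib]
      congr 1
      refine Finset.sum_congr rfl fun t _ => ?_
      have : Nonempty T := ⟨t⟩
      have hc : (Fintype.card T : ℝ) ≠ 0 := Nat.cast_ne_zero.2 Fintype.card_ne_zero
      have h1 := (classCard_cast_pos r t).ne'
      have h2 := (classCard_cast_pos q t).ne'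
      rw [Real.logb_div h1 h2, Real.logb_div hc h1, Real.logb_div hc h2]
      ring
    rw [this] at h
    linarith
  intro v
  have hq := classCard_cast_pos q v
  calc ∑ t with s v t, (classCard r t : ℝ) / classCard q t / classCard (r ⊓ s) t
      -- The numerator is expanded as a count of `u`. After the exchange of sums, the `t` belonging
      -- to a fixed `u` lie in one class of `r ⊓ s`.
      = ∑ t with s v t, ∑ u with r t u, 1 / (classCard q v : ℝ) * (1 / classCard (r ⊓ s) t) := by
        refine Finset.sum_congr rfl fun t ht => ?_
        rw [Finset.sum_const, nsmul_eq_mul, classCard_congr (hs (Finset.mem_filter.1 ht).2)]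
        change (classCard r t : ℝ) / _ / _ = (classCard r t : ℝ) * _
        ring
    _ = ∑ u with q v u, ∑ t with s v t ∧ r t u,
          1 / (classCard q v : ℝ) * (1 / classCard (r ⊓ s) t) := by
        refine Finset.sum_comm' fun t u => ?_
        simp only [Finset.mem_filter, Finset.mem_univ, true_and]
        exact ⟨fun h => ⟨h, q.trans' (hs h.1) (hr h.2)⟩, fun h => h.1⟩
    _ ≤ ∑ u with q v u, 1 / (classCard q v : ℝ) * 1 := by
        refine Finset.sum_le_sum fun u _ => ?_
        rw [← Finset.mul_sum]
        refine mul_le_mul_of_nonneg_left ?_ (by positivity)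
        refine sum_inv_classCard_le_one _ _ fun t ht t' ht' => ?_
        simp only [Finset.mem_filter, Finset.mem_univ, true_and] at ht ht'
        exact ⟨r.trans' ht.2 (r.symm' ht'.2), s.trans' (s.symm' ht.1) ht'.1⟩
    _ = 1 := by
        rw [Finset.sum_const, nsmul_eq_mul]
        change (classCard q v : ℝ) * _ = 1
        field_simp

/-- The sum over a class of `s` of a weight which depends on the class of `ker f` only is a sum
over the values of `f`. -/
theorem sum_div_classCard_inf_ker_le {B : Type*} [Fintype B] (s : Setoid T) (f : T → B)
    (P : Finset T) (hP : ∀ t ∈ P, ∀ u ∈ P, s t u) (w : B → ℝ) (hw : ∀ x, 0 ≤ w x) :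
    ∑ t ∈ P, w (f t) / classCard (s ⊓ Setoid.ker f) t ≤ ∑ x, w x := by
  classical
  rw [← Finset.sum_fiberwise_of_maps_to (s := P) (t := Finset.univ) (g := f) (by simp)]
  refine Finset.sum_le_sum fun x _ => ?_
  calc ∑ t ∈ P with f t = x, w (f t) / classCard (s ⊓ Setoid.ker f) t
      = w x * ∑ t ∈ P with f t = x, 1 / (classCard (s ⊓ Setoid.ker f) t : ℝ) := by
        rw [Finset.mul_sum]
        refine Finset.sum_congr rfl fun t ht => ?_
        rw [(Finset.mem_filter.1 ht).2]
        ring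
    _ ≤ w x * 1 := by
        refine mul_le_mul_of_nonneg_left (sum_inv_classCard_le_one _ _ fun t ht u hu => ?_) (hw x)
        simp only [Finset.mem_filter] at ht hu
        exact ⟨hP t ht.1 u hu.1, Setoid.ker_def.2 (ht.2.trans hu.2.symm)⟩
    _ = w x := mul_one _

/-- Gibbs' inequality relative to the trivial partition, with the uniform weight on `B`. -/
theorem setoidEntropy_ker_le_logb_card {B : Type*} [Fintype B] (f : T → B) :
    setoidEntropy (Setoid.ker f) ≤ Real.logb 2 (Fintype.card B) := by
  classical
  rcases isEmpty_or_nonempty T with hT | hT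
  · simpa [setoidEntropy, Real.logb] using
      div_nonneg (Real.log_natCast_nonneg (Fintype.card B)) (Real.log_pos one_lt_two).le
  have hB : Nonempty B := hT.map f
  have hc : (0 : ℝ) < Fintype.card B := Nat.cast_pos.2 Fintype.card_pos
  have hT' : (0 : ℝ) < Fintype.card T := Nat.cast_pos.2 Fintype.card_pos
  have h := setoidEntropy_le_add_of_subprobability (⊤ ⊓ Setoid.ker f) ⊤
    (fun _ => 1 / (Fintype.card B : ℝ)) (fun _ => by positivity) fun v =>
      (sum_div_classCard_inf_ker_le ⊤ f _ (fun _ _ _ _ => trivial)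
        (fun _ => 1 / (Fintype.card B : ℝ)) fun _ => by positivity).trans
          (le_of_eq (by simp))
  rw [top_inf_eq, setoidEntropy_top, zero_add] at h
  refine h.trans (le_of_eq ?_)
  simp only [one_div, Real.logb_inv, neg_neg, Finset.sum_const, Finset.card_univ, nsmul_eq_mul]
  field_simp

open scoped Classical in
/-- Fano's inequality, for an estimator `g` of `f` which is determined by the class of `s`. -/
theorem setoidEntropy_inf_ker_le_fano {B : Type*} [Fintype B] (s : Setoid T) (f g : T → B)
    (hg : s ≤ Setoid.ker g) :
    setoidEntropy (s ⊓ Setoid.ker f) ≤ setoidEntropy s + (1 +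
      ((Finset.univ.filter fun t => g t ≠ f t).card : ℝ) / Fintype.card T *
        Real.logb 2 (Fintype.card B)) := by
  rcases isEmpty_or_nonempty T with hT | hT
  · simp [setoidEntropy]
  have hB : Nonempty B := hT.map f
  have hc : (0 : ℝ) < Fintype.card B := Nat.cast_pos.2 Fintype.card_pos
  have hT' : (0 : ℝ) < Fintype.card T := Nat.cast_pos.2 Fintype.card_pos
  have h := setoidEntropy_le_add_of_subprobability (s ⊓ Setoid.ker f) s
    -- Half of the mass sits on the estimate and half is spread over `B`: a correct guess costs one
    -- bit, a wrong one `1 + log₂ |B|`. The constant 1 replaces the binary entropy of the error and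
    -- disappears after division by the block length.
    (fun t => if g t = f t then 1 / 2 else 1 / 2 / (Fintype.card B : ℝ))
    (fun _ => by split_ifs <;> positivity) ?_
  · refine h.trans (add_le_add_right (le_of_eq ?_) _)
    have hval : ∀ t, -Real.logb 2 (if g t = f t then 1 / 2 else 1 / 2 / (Fintype.card B : ℝ))
        = 1 + if g t ≠ f t then Real.logb 2 (Fintype.card B) else 0 := by
      intro t
      have h2 : Real.logb 2 (1 / 2) = -1 := by
        rw [one_div, Real.logb_inv, Real.logb_self_eq_one one_lt_two]
      by_cases ht : g t = f t
      · simp [ht]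
      · rw [if_neg ht, if_pos ht, Real.logb_div (by norm_num) hc.ne', h2]
        ring
    rw [Finset.sum_congr rfl fun t _ => hval t, Finset.sum_add_distrib, ← Finset.sum_filter,
      Finset.sum_const, Finset.sum_const, Finset.card_univ, nsmul_eq_mul, nsmul_eq_mul]
    field_simp
  intro v
  have hle := sum_div_classCard_inf_ker_le s f (Finset.univ.filter fun t => s v t)
    (fun t ht u hu => by
      simp only [Finset.mem_filter, Finset.mem_univ, true_and] at ht hu
      exact s.trans' (s.symm' ht) hu)
    (fun x => if g v = x then 1 / 2 else 1 / 2 / (Fintype.card B : ℝ))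
    (fun _ => by split_ifs <;> positivity)
  refine (le_of_eq ?_).trans (hle.trans ?_)
  · refine Finset.sum_congr rfl fun t ht => ?_
    rw [(Setoid.ker_def.1 (hg (Finset.mem_filter.1 ht).2) : g v = g t)]
  · calc ∑ x, (if g v = x then 1 / 2 else 1 / 2 / (Fintype.card B : ℝ))
        ≤ ∑ x, ((if g v = x then 1 / 2 else 0) + 1 / 2 / (Fintype.card B : ℝ)) := by
          refine Finset.sum_le_sum fun x _ => ?_
          have : 0 < 1 / 2 / (Fintype.card B : ℝ) := by positivity
          split_ifs <;> linarith
      _ = 1 := by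
          rw [Finset.sum_add_distrib]
          simp only [Finset.sum_ite_eq, Finset.mem_univ, if_true, Finset.sum_const,
            Finset.card_univ, nsmul_eq_mul]
          field_simp
          norm_num

end PartitionEntropy
end

noncomputable section

/-! ### Uniformly distributed random variables -/

section Uniform

variable {T : Type*} [Fintype T]

theorem sum_comp_eval_div_card {ι : Type*} [Fintype ι] [DecidableEq ι] (n : ι) (f : T → ℝ) :
    (∑ t : ι → T, f (t n)) / Fintype.card (ι → T) = (∑ t, f t) / Fintype.card T := by
  rcases isEmpty_or_nonempty T with hT | hT
  · have : IsEmpty (ι → T) := ⟨fun t => hT.elim (t n)⟩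
    simp
  have h := Fintype.sum_equiv (Equiv.funSplitAt n T) (fun t : ι → T => f (t n))
    (fun p => f p.1) fun t => rfl
  rw [h, Fintype.card_congr (Equiv.funSplitAt n T), Fintype.sum_prod_type]
  have hc : (Fintype.card ({j // j ≠ n} → T) : ℝ) ≠ 0 := Nat.cast_ne_zero.2 Fintype.card_ne_zero
  simp only [Finset.sum_const, Finset.card_univ, nsmul_eq_mul, ← Finset.mul_sum]
  rw [Fintype.card_prod, Nat.cast_mul, mul_comm (Fintype.card T : ℝ), mul_div_mul_left _ _ hc]

theorem classCard_piSetoid {ι : Type*} [Fintype ι] [DecidableEq ι] (r : ι → Setoid T)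
    (t : ι → T) :
    classCard (@piSetoid ι (fun _ => T) r) t = ∏ i, classCard (r i) (t i) := by
  classical
  unfold classCard
  rw [← Fintype.card_piFinset]
  congr 1
  ext u
  simp only [Finset.mem_filter, Finset.mem_univ, true_and, Fintype.mem_piFinset]
  exact Setoid.piSetoid_apply

/-- The entropy of independent components is the sum of their entropies. -/
theorem setoidEntropy_piSetoid {ι : Type*} [Fintype ι] [DecidableEq ι] (r : ι → Setoid T) :
    setoidEntropy (@piSetoid ι (fun _ => T) r) = ∑ i, setoidEntropy (r i) := by
  have hlog : ∀ t : ι → T, Real.logb 2 (Fintype.card (ι → T) /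
      classCard (@piSetoid ι (fun _ => T) r) t)
      = ∑ i, Real.logb 2 (Fintype.card T / classCard (r i) (t i)) := by
    intro t
    rw [classCard_piSetoid, Fintype.card_fun, ← Finset.card_univ (α := ι), ← Finset.prod_const,
      Nat.cast_prod, Nat.cast_prod, ← Finset.prod_div_distrib, Real.logb_prod]
    intro i _
    have : Nonempty T := ⟨t i⟩
    exact div_ne_zero (Nat.cast_ne_zero.2 Fintype.card_ne_zero) (classCard_cast_pos _ _).ne'
  unfold setoidEntropy
  rw [Finset.sum_congr rfl fun t _ => hlog t, Finset.sum_comm, Finset.sum_div]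
  exact Finset.sum_congr rfl fun i _ => sum_comp_eval_div_card i
    fun t => Real.logb 2 (Fintype.card T / classCard (r i) t)

variable {Ω : Type*} [MeasurableSpace Ω]

/-- `B` is uniformly distributed on the finite set `T`. -/
structure IsUniformOn (μ : Measure Ω) (B : Ω → T) : Prop where
  measurableSet : ∀ t, MeasurableSet (B ⁻¹' {t})
  measureReal : ∀ t, μ.real (B ⁻¹' {t}) = 1 / Fintype.card T

open scoped Classical in
theorem IsUniformOn.measureReal_setOf {μ : Measure Ω} [IsFiniteMeasure μ] {B : Ω → T}
    (hB : IsUniformOn μ B) (P : T → Prop) :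
    μ.real {ω | P (B ω)} = ((Finset.univ.filter P).card : ℝ) / Fintype.card T := by
  have : {ω | P (B ω)} = ⋃ t ∈ Finset.univ.filter P, B ⁻¹' {t} := by
    ext ω
    simp
  rw [this, measureReal_biUnion_finset _ fun t _ => hB.measurableSet t]
  · simp [hB.measureReal, div_eq_mul_inv]
  · intro t _ u _ htu
    exact Disjoint.preimage _ (by simpa using htu)

/-- This turns error probabilities on the product space into proportions of blocks. -/
theorem IsUniformOn.pi {μ : Measure Ω} [IsFiniteMeasure μ] {B : Ω → T}
    (hB : IsUniformOn μ B) {ι : Type*} [Fintype ι] [DecidableEq ι] :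
    IsUniformOn (Measure.pi fun _ : ι => μ) (fun ω (i : ι) => B (ω i)) := by
  have hpre : ∀ t : ι → T, (fun (ω : ι → Ω) (i : ι) => B (ω i)) ⁻¹' {t}
      = Set.univ.pi fun i => B ⁻¹' {t i} := by
    intro t
    ext ω
    simp [funext_iff]
  constructor
  · intro t
    rw [hpre]
    exact MeasurableSet.univ_pi fun i => hB.measurableSet _
  · intro t
    rw [hpre, measureReal_def, Measure.pi_pi, ENNReal.toReal_prod]
    have : ∀ i, (μ (B ⁻¹' {t i})).toReal = 1 / Fintype.card T := fun i => hB.measureReal (t i)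
    simp [this]

/-- The bridge from probability to counting: the points of one fibre of `F` contribute equal terms,
which add up to the term `-p log p` of the corresponding value. -/
theorem IsUniformOn.shannonEntropy_comp {μ : Measure Ω} [IsFiniteMeasure μ] {B : Ω → T}
    (hB : IsUniformOn μ B) {A : Type*} [Finite A] (F : T → A) :
    shannonEntropy μ (fun ω => F (B ω)) = setoidEntropy (Setoid.ker F) := by
  classical
  have := Fintype.ofFinite A
  unfold shannonEntropy setoidEntropy
  rw [finsum_eq_sum_of_fintype, Finset.sum_div, Finset.sum_div,
    ← Finset.sum_fiberwise_of_maps_to (s := Finset.univ) (t := Finset.univ) (g := F) (by simp)]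
  refine Finset.sum_congr rfl fun a _ => ?_
  have h1 : μ.real ((fun ω => F (B ω)) ⁻¹' {a})
      = ((Finset.univ.filter fun t => F t = a).card : ℝ) / Fintype.card T := by
    rw [← hB.measureReal_setOf fun t => F t = a]
    rfl
  have h2 : ∀ t ∈ Finset.univ.filter fun t => F t = a,
      Real.logb 2 (Fintype.card T / classCard (Setoid.ker F) t) / Fintype.card T
      = Real.logb 2 (Fintype.card T / (Finset.univ.filter fun t => F t = a).card)
        / Fintype.card T := by
    intro t ht
    have : classCard (Setoid.ker F) t = (Finset.univ.filter fun t => F t = a).card := by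
      unfold classCard
      congr 1
      ext u
      simp [Setoid.ker_def, (Finset.mem_filter.1 ht).2, eq_comm]
    rw [this]
  rw [h1, Finset.sum_congr rfl h2, Finset.sum_const, nsmul_eq_mul, Real.negMulLog, Real.logb,
    ← inv_div (Fintype.card T : ℝ), Real.log_inv]
  simp only [div_eq_mul_inv, mul_inv, inv_inv]
  ring

end Uniform

/-! ### Constructions of polymatroids -/

section Polymatroid

variable {Z W : Type*}

theorem IsPolymatroid.const_mul {h : Set Z → ℝ} (hh : IsPolymatroid h) {a : ℝ} (ha : 0 ≤ a) :
    IsPolymatroid fun β => a * h β where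
  empty := by simp [hh.empty]
  nonneg β := mul_nonneg ha (hh.nonneg β)
  mono α β hβ := mul_le_mul_of_nonneg_left (hh.mono α β hβ) ha
  submodular α β := by
    rw [← mul_add, ← mul_add]
    exact mul_le_mul_of_nonneg_left (hh.submodular α β) ha

/-- The pullback of a polymatroid along a map which sends elements to sets. -/
theorem IsPolymatroid.biUnion {h : Set W → ℝ} (hh : IsPolymatroid h) (F : Z → Set W) :
    IsPolymatroid fun β => h (⋃ z ∈ β, F z) where
  empty := by simp [hh.empty]
  nonneg β := hh.nonneg _
  mono α β hβ := hh.mono _ _ (Set.biUnion_subset_biUnion_left hβ)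
  submodular α β := by
    rw [Set.biUnion_union]
    refine le_trans (add_le_add_left (hh.mono _ _ ?_) _) (hh.submodular _ _)
    exact Set.subset_inter (Set.biUnion_subset_biUnion_left Set.inter_subset_left)
      (Set.biUnion_subset_biUnion_left Set.inter_subset_right)

theorem IsPolymatroid.image {h : Set W → ℝ} (hh : IsPolymatroid h) (φ : Z → W) :
    IsPolymatroid fun β => h (φ '' β) := by
  simpa only [Set.biUnion_of_singleton, ← Set.image_eq_iUnion] using hh.biUnion fun z => {φ z}

/-- The rank function of the uniform matroid of rank `k`. -/
theorem isPolymatroid_min_ncard [Finite W] (k : ℕ) :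
    IsPolymatroid fun β : Set W => ((min k β.ncard : ℕ) : ℝ) where
  empty := by simp
  nonneg β := Nat.cast_nonneg _
  mono α β hβ := by
    exact_mod_cast min_le_min_left k (Set.ncard_le_ncard hβ)
  submodular α β := by
    have h1 := Set.ncard_union_add_ncard_inter α β
    have h2 := Set.ncard_le_ncard (Set.inter_subset_left (s := α) (t := β))
    have h3 := Set.ncard_le_ncard (Set.inter_subset_right (s := α) (t := β))
    exact_mod_cast (by omega : min k (α ∩ β).ncard + min k (α ∪ β).ncard
      ≤ min k α.ncard + min k β.ncard)

/-! ### Calculus of functional dependence in a polymatroid -/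

theorem IsPolymatroid.add_le_add_of_subset {h : Set Z → ℝ} (hh : IsPolymatroid h)
    {α β γ δ : Set Z} (hγα : γ ⊆ α) (hγβ : γ ⊆ β) (hδ : δ ⊆ α ∪ β) : h γ + h δ ≤ h α + h β :=
  (add_le_add (hh.mono _ _ (Set.subset_inter hγα hγβ)) (hh.mono _ _ hδ)).trans
    (hh.submodular α β)

theorem condRank_nonneg {h : Set Z → ℝ} (hh : IsPolymatroid h) (α β : Set Z) :
    0 ≤ condRank h α β :=
  sub_nonneg.2 (hh.mono _ _ Set.subset_union_right)

theorem condRank_eq_zero_iff_le {h : Set Z → ℝ} (hh : IsPolymatroid h) {α β : Set Z} :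
    condRank h α β = 0 ↔ h (α ∪ β) ≤ h β := by
  rw [← sub_nonpos]
  exact ⟨fun h0 => h0.le, fun h0 => le_antisymm h0 (condRank_nonneg hh α β)⟩

theorem condRank_eq_zero_of_subset (h : Set Z → ℝ) {α β : Set Z}
    (hαβ : α ⊆ β) : condRank h α β = 0 := by
  rw [condRank, Set.union_eq_right.2 hαβ, sub_self]

/-- Submodularity for `α ∪ β` and `γ`, whose intersection contains `β`. -/
theorem condRank_eq_zero_mono {h : Set Z → ℝ} (hh : IsPolymatroid h) {α β γ : Set Z}
    (hβγ : β ⊆ γ) (h0 : condRank h α β = 0) : condRank h α γ = 0 := by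
  rw [condRank_eq_zero_iff_le hh] at h0 ⊢
  have := hh.add_le_add_of_subset (α := α ∪ β) (β := γ) (γ := β) (δ := α ∪ γ)
    Set.subset_union_right hβγ
    (Set.union_subset_union_left γ Set.subset_union_left)
  linarith

theorem condRank_union_eq_zero {h : Set Z → ℝ} (hh : IsPolymatroid h) {α β γ : Set Z}
    (hα : condRank h α γ = 0) (hβ : condRank h β γ = 0) : condRank h (α ∪ β) γ = 0 := by
  have h1 := condRank_eq_zero_mono hh (Set.subset_union_right (s := β) (t := γ)) hα
  rw [condRank_eq_zero_iff_le hh] at hβ h1 ⊢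
  rw [Set.union_assoc]
  exact h1.trans hβ

theorem condRank_eq_zero_of_forall {h : Set Z → ℝ} (hh : IsPolymatroid h) {α β : Set Z}
    (hα : α.Finite) (H : ∀ a ∈ α, condRank h {a} β = 0) : condRank h α β = 0 := by
  induction α, hα using Set.Finite.induction_on with
  | empty => exact condRank_eq_zero_of_subset h (Set.empty_subset β)
  | insert _ _ ih =>
    rw [Set.insert_eq]
    exact condRank_union_eq_zero hh (H _ (Set.mem_insert _ _))
      (ih fun a ha => H a (Set.mem_insert_of_mem _ ha))

theorem condRank_eq_zero_trans {h : Set Z → ℝ} (hh : IsPolymatroid h) {α β γ : Set Z}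
    (hαβ : condRank h α β = 0) (hβγ : condRank h β γ = 0) : condRank h α γ = 0 := by
  have h1 := condRank_eq_zero_mono hh (Set.subset_union_left (s := β) (t := γ)) hαβ
  rw [condRank_eq_zero_iff_le hh] at hβγ h1 ⊢
  exact (hh.mono _ _ (Set.union_subset_union_right α Set.subset_union_right)).trans
    (h1.trans hβγ)

theorem le_of_condRank_eq_zero {h : Set Z → ℝ} (hh : IsPolymatroid h) {α β : Set Z}
    (h0 : condRank h α β = 0) : h α ≤ h β :=
  (hh.mono _ _ Set.subset_union_left).trans ((condRank_eq_zero_iff_le hh).1 h0)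

/-! ### Entropic polymatroids and closedness of the polymatroid axioms -/

variable {T : Type*} [Fintype T]

/-- The joint entropy of the partitions `V z`, `z ∈ β`. -/
def entropicRank (V : Z → Setoid T) (β : Set Z) : ℝ := setoidEntropy (⨅ z ∈ β, V z)

theorem isPolymatroid_entropicRank (V : Z → Setoid T) : IsPolymatroid (entropicRank V) where
  empty := by simp [entropicRank, setoidEntropy_top]
  nonneg β := setoidEntropy_nonneg _
  mono α β hβ := setoidEntropy_anti (biInf_mono hβ)
  submodular α β := by
    unfold entropicRank
    rw [iInf_union]
    exact setoidEntropy_submodular (biInf_mono Set.inter_subset_left)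
      (biInf_mono Set.inter_subset_right)

theorem isClosed_setOf_isPolymatroid : IsClosed {h : Set Z → ℝ | IsPolymatroid h} := by
  have : {h : Set Z → ℝ | IsPolymatroid h} = {h | h ∅ = 0} ∩ (⋂ β, {h | 0 ≤ h β}) ∩
      (⋂ α, ⋂ β, ⋂ (_ : β ⊆ α), {h | h β ≤ h α}) ∩
      ⋂ α, ⋂ β, {h | h (α ∩ β) + h (α ∪ β) ≤ h α + h β} := by
    ext h
    simp only [Set.mem_ofPred_eq, Set.mem_inter_iff, Set.mem_iInter]
    exact ⟨fun hh => ⟨⟨⟨hh.empty, hh.nonneg⟩, hh.mono⟩, hh.submodular⟩,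
      fun hh => ⟨hh.1.1.1, hh.1.1.2, hh.1.2, hh.2⟩⟩
  rw [this]
  refine (((isClosed_eq (by fun_prop) (by fun_prop)).inter ?_).inter ?_).inter ?_
  · exact isClosed_iInter fun β => isClosed_le (by fun_prop) (by fun_prop)
  · exact isClosed_iInter fun α => isClosed_iInter fun β => isClosed_iInter fun _ =>
      isClosed_le (by fun_prop) (by fun_prop)
  · exact isClosed_iInter fun α => isClosed_iInter fun β =>
      isClosed_le (by fun_prop) (by fun_prop)

end Polymatroid
end

noncomputable section

/-! ### The improved linear programming bound is an outer bound -/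

theorem iInf_setoid_iff {Z T : Type*} (V : Z → Setoid T) (β : Set Z) (t u : T) :
    (⨅ z ∈ β, V z) t u ↔ ∀ z ∈ β, V z t u := by
  rw [← sInf_image, Setoid.sInf_iff]
  simp

theorem condRank_entropicRank_eq_zero {Z T : Type*} [Fintype T] {V : Z → Setoid T} {w : Z}
    {β : Set Z} (h : ⨅ z ∈ β, V z ≤ V w) : condRank (entropicRank V) {w} β = 0 := by
  rw [condRank, entropicRank, entropicRank, iInf_union, iInf_singleton, inf_eq_right.2 h, sub_self]

/-- Values outside the range of `g` have empty fibres and contribute 0. Needed to discard an empty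
vector of auxiliary variables. -/
theorem shannonEntropy_comp_injective {Ω A B : Type*} [MeasurableSpace Ω] [Finite A] [Finite B]
    (μ : Measure Ω) (X : Ω → A) {g : A → B} (hg : Function.Injective g) :
    shannonEntropy μ (fun ω => g (X ω)) = shannonEntropy μ X := by
  have hsupp : Function.support (fun y => Real.negMulLog (μ.real ((fun ω => g (X ω)) ⁻¹' {y})))
      ⊆ Set.range g := by
    intro y hy
    by_contra hy'
    refine hy ?_
    have : (fun ω => g (X ω)) ⁻¹' {y} = ∅ :=
      Set.eq_empty_of_forall_notMem fun ω hω => hy' ⟨X ω, hω⟩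
    simp [this]
  unfold shannonEntropy
  rw [← Set.indicator_eq_self.2 hsupp, ← finsum_mem_def, finsum_mem_range hg]
  congr 2
  ext a
  congr 2
  ext ω
  simp [hg.eq_iff]

namespace SourceNetwork

variable {V E S : Type*}

theorem LinkConstraints.comp_image {G : SourceNetwork V E S} {Z W : Type*} {src : S → Z}
    {edg : E → Z} {φ : Z → W} {h : Set W → ℝ} {C : E → ℝ}
    (H : G.LinkConstraints (φ ∘ src) (φ ∘ edg) h C) :
    G.LinkConstraints src edg (fun β => h (φ '' β)) C where
  encoding e := by
    simpa [condRank, Set.image_insert_eq, Set.image_union, Set.image_image] using H.encoding e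
  decoding s u hu := by
    simpa [condRank, Set.image_insert_eq, Set.image_union, Set.image_image] using H.decoding s u hu
  capacity e := by simpa using H.capacity e

variable {T : Type*}

section Code

variable [Finite E] {G : SourceNetwork V E S} {Y : S → Type*} {N : ℕ} {L : Type*} {A : L → Type*}

/-- The partitions of the set of blocks of length `N` induced by the source blocks, by the messages
of a code and by the blocks of auxiliary variables. -/
def Code.partition (c : G.Code Y N) (X : ∀ s, T → Y s) (K : ∀ i, T → A i) :
    S ⊕ E ⊕ L → Setoid (Fin N → T)
  | Sum.inl s => Setoid.ker fun t n => X s (t n)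
  | Sum.inr (Sum.inl e) => Setoid.ker fun t => c.message (fun s n => X s (t n)) e
  | Sum.inr (Sum.inr i) => Setoid.ker fun t n => K i (t n)

variable (c : G.Code Y N) (X : ∀ s, T → Y s) (K : ∀ i, T → A i)

theorem Code.partition_known_at {u : V} {t t' : Fin N → T}
    (h : (⨅ z ∈ Sum.inl '' G.sourcesAt u ∪ (Sum.inr ∘ Sum.inl) '' G.edgesInto u,
      c.partition X K z) t t') :
    (fun (s : G.sourcesAt u) n => X s (t n)) = (fun (s : G.sourcesAt u) n => X s (t' n)) ∧
    (fun f : G.edgesInto u => c.message (fun s n => X s (t n)) f) =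
      fun f : G.edgesInto u => c.message (fun s n => X s (t' n)) f := by
  rw [iInf_setoid_iff] at h
  constructor
  · ext1 s
    exact Setoid.ker_def.1 (h (Sum.inl s) (Or.inl ⟨s, s.2, rfl⟩))
  · ext1 f
    exact Setoid.ker_def.1 (h (Sum.inr (Sum.inl f)) (Or.inr ⟨f, f.2, rfl⟩))

variable [Fintype T]

/-- Two blocks agree in the selected variables exactly if they agree at each time, so the joint
partition is a product of `N` copies of the single-letter one. -/
theorem Code.entropicRank_partition_source (α : Set S) (β : Set L) :
    entropicRank (c.partition X K) (Sum.inl '' α ∪ (Sum.inr ∘ Sum.inr) '' β)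
      = N * setoidEntropy (Setoid.ker fun t => (subvector X α t, subvector K β t)) := by
  have h := setoidEntropy_piSetoid fun _ : Fin N =>
    Setoid.ker fun t => (subvector X α t, subvector K β t)
  rw [Finset.sum_const, Finset.card_univ, Fintype.card_fin, nsmul_eq_mul] at h
  rw [← h, entropicRank]
  congr 1
  ext t u
  rw [iInf_setoid_iff, Setoid.piSetoid_apply]
  constructor
  · intro H n
    refine Setoid.ker_def.2 (Prod.ext (funext fun s => ?_) (funext fun i => ?_))
    · exact congrFun (Setoid.ker_def.1 (H (Sum.inl s) (Or.inl ⟨s, s.2, rfl⟩))) n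
    · exact congrFun (Setoid.ker_def.1 (H (Sum.inr (Sum.inr i)) (Or.inr ⟨i, i.2, rfl⟩))) n
  · rintro H z (⟨s, hs, rfl⟩ | ⟨i, hi, rfl⟩)
    · exact Setoid.ker_def.2 (funext fun n =>
        congrFun (Prod.ext_iff.1 (Setoid.ker_def.1 (H n))).1 ⟨s, hs⟩)
    · exact Setoid.ker_def.2 (funext fun n =>
        congrFun (Prod.ext_iff.1 (Setoid.ker_def.1 (H n))).2 ⟨i, hi⟩)

theorem Code.condRank_partition_encoding (e : E) :
    condRank (entropicRank (c.partition X K)) {Sum.inr (Sum.inl e)}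
      (Sum.inl '' G.sourcesAt (G.tail e) ∪ (Sum.inr ∘ Sum.inl) '' G.edgesInto (G.tail e)) = 0 := by
  refine condRank_entropicRank_eq_zero fun {t t'} h => ?_
  obtain ⟨h1, h2⟩ := c.partition_known_at X K h
  refine Setoid.ker_def.2 ?_
  rw [c.message_eq, c.message_eq (fun s n => X s (t' n)), h1, h2]

/-- Fano's inequality with the decoder as estimator; it depends only on what node `u` sees. The
alphabet of blocks has `|Y s| ^ N` elements. -/
theorem Code.condRank_partition_decoding [∀ s, Fintype (Y s)] {Ω : Type*} [MeasurableSpace Ω]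
    {μ : Measure Ω} [IsFiniteMeasure μ] {B : Ω → T} (hB : IsUniformOn μ B)
    (s : S) (u : V) (hu : u ∈ G.demand s) :
    condRank (entropicRank (c.partition X K)) {Sum.inl s}
      (Sum.inl '' G.sourcesAt u ∪ (Sum.inr ∘ Sum.inl) '' G.edgesInto u) ≤
    1 + c.errorProb μ (fun s ω => X s (B ω)) s u hu *
      (N * Real.logb 2 (Fintype.card (Y s))) := by
  classical
  have h := setoidEntropy_inf_ker_le_fano
    (⨅ z ∈ Sum.inl '' G.sourcesAt u ∪ (Sum.inr ∘ Sum.inl) '' G.edgesInto u, c.partition X K z)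
    (fun t n => X s (t n)) (fun t => c.decoded (fun s n => X s (t n)) s u hu)
    (fun {t t'} h => by
      obtain ⟨h1, h2⟩ := c.partition_known_at X K h
      refine Setoid.ker_def.2 ?_
      unfold Code.decoded
      rw [h1, h2])
  have herr : c.errorProb μ (fun s ω => X s (B ω)) s u hu = _ :=
    (hB.pi (ι := Fin N)).measureReal_setOf
      fun t => c.decoded (fun s n => X s (t n)) s u hu ≠ fun n => X s (t n)
  rw [Fintype.card_fun (α := Fin N) (β := Y s), Fintype.card_fin, Nat.cast_pow,
    Real.logb_pow] at h
  rw [herr, condRank, entropicRank, entropicRank, iInf_union, iInf_singleton, inf_comm,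
    sub_le_iff_le_add']
  convert h using 1
  · rfl
  · congr!

theorem Code.entropicRank_partition_edge_le (e : E) :
    entropicRank (c.partition X K) {Sum.inr (Sum.inl e)} ≤ Real.logb 2 (c.size e) := by
  rw [entropicRank, iInf_singleton]
  exact (setoidEntropy_ker_le_logb_card _).trans (by rw [Fintype.card_fin])

end Code

/-- The improved bound is an outer bound, for sources and auxiliary variables which are functions of
a random variable with uniform distribution on a finite set. -/
theorem achievableRegion_subset_improvedRegion [Fintype T] [Finite E] [Finite S] (G : SourceNetwork V E S)
    {Y : S → Type*} [∀ s, Finite (Y s)] {L : Type*} {A : L → Type*} [Finite L] [∀ i, Finite (A i)]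
    {Ω : Type*} [MeasurableSpace Ω] {μ : Measure Ω} [IsFiniteMeasure μ] {B : Ω → T}
    (hB : IsUniformOn μ B) (X : ∀ s, T → Y s) (K : ∀ i, T → A i) :
    G.achievableRegion μ (fun s ω => X s (B ω)) ⊆
      G.improvedRegion μ (fun s ω => X s (B ω)) (fun i ω => K i (B ω)) (polymatroids _) := by
  rintro C ⟨c, hrate, herr⟩
  have : ∀ s, Fintype (Y s) := fun s => Fintype.ofFinite _
  -- At `N = 0` the inverse is 0 and the function vanishes, which is harmless in the limit.
  let h : ℕ → Set (S ⊕ E ⊕ L) → ℝ := fun N β =>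
    (N : ℝ)⁻¹ * entropicRank ((c N).partition X K) β
  have hpoly : ∀ N, IsPolymatroid (h N) := fun N =>
    (isPolymatroid_entropicRank _).const_mul (by positivity)
  have hbdd : ∀ N, h N ∈ Set.univ.pi fun _ => Set.Icc 0 (Real.logb 2 (Fintype.card T)) := by
    intro N β _
    refine ⟨(hpoly N).nonneg β, ?_⟩
    have hle := setoidEntropy_le_logb_card (⨅ z ∈ β, (c N).partition X K z)
    rw [Fintype.card_fun, Fintype.card_fin, Nat.cast_pow, Real.logb_pow] at hle
    rcases N.eq_zero_or_pos with rfl | hN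
    · simpa [h, Real.logb] using
        div_nonneg (Real.log_natCast_nonneg (Fintype.card T)) (Real.log_pos one_lt_two).le
    · have hN' : (0 : ℝ) < N := Nat.cast_pos.2 hN
      exact (inv_mul_le_iff₀ hN').2 hle
  -- An ultrafilter finer than `atTop` makes all coordinates converge at once by compactness,
  -- without extracting a subsequence.
  let U : Ultrafilter ℕ := Ultrafilter.of atTop
  have hU : (U : Filter ℕ) ≤ atTop := Ultrafilter.of_le _
  obtain ⟨x, -, hx⟩ := (isCompact_univ_pi fun _ : Set (S ⊕ E ⊕ L) =>
    isCompact_Icc (a := (0 : ℝ)) (b := Real.logb 2 (Fintype.card T))).ultrafilter_le_nhds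
      (U.map h) (le_principal_iff.2 (Filter.mem_map.2 (Filter.univ_mem' hbdd)))
  have hlim : ∀ β, Tendsto (fun N => h N β) U (𝓝 (x β)) := tendsto_pi_nhds.1 hx
  have hcond : ∀ α β, Tendsto (fun N => condRank (h N) α β) U (𝓝 (condRank x α β)) :=
    fun α β => (hlim _).sub (hlim _)
  have hcondRank : ∀ N α β, condRank (h N) α β =
      (N : ℝ)⁻¹ * condRank (entropicRank ((c N).partition X K)) α β := fun N α β =>
    (mul_sub _ _ _).symm
  have hxpoly : IsPolymatroid x :=
    isClosed_setOf_isPolymatroid.mem_of_tendsto hx (Filter.Eventually.of_forall hpoly)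
  refine ⟨x, hxpoly, fun α β => ?_, ⟨fun e => ?_, fun s u hu => ?_, fun e => ?_⟩⟩
  · rw [sub_eq_zero]
    refine tendsto_nhds_unique (hlim _) (tendsto_const_nhds.congr' ?_)
    filter_upwards [hU (eventually_gt_atTop 0)] with N hN
    have hN' : (N : ℝ) ≠ 0 := Nat.cast_ne_zero.2 hN.ne'
    change _ = (N : ℝ)⁻¹ * _
    rw [Code.entropicRank_partition_source, inv_mul_cancel_left₀ hN']
    exact hB.shannonEntropy_comp fun t => (subvector X α t, subvector K β t)
  · refine tendsto_nhds_unique (hcond _ _) (tendsto_const_nhds.congr fun N => ?_)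
    rw [hcondRank, Function.comp_apply, Code.condRank_partition_encoding, mul_zero]
  · refine le_antisymm ?_ (condRank_nonneg hxpoly _ _)
    -- This is the Fano bound divided by `N`.
    have hbound : Tendsto (fun N : ℕ => (N : ℝ)⁻¹ +
        (c N).errorProb μ (fun s ω => X s (B ω)) s u hu * Real.logb 2 (Fintype.card (Y s)))
        U (𝓝 0) := by
      have := (tendsto_inv_atTop_nhds_zero_nat (𝕜 := ℝ)).add
        ((herr s u hu).mul_const (Real.logb 2 (Fintype.card (Y s))))
      rw [zero_mul, add_zero] at this
      exact this.mono_left hU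
    refine le_of_tendsto_of_tendsto (hcond _ _) hbound ?_
    filter_upwards [hU (eventually_gt_atTop 0)] with N hN
    have hN' : (0 : ℝ) < N := Nat.cast_pos.2 hN
    rw [hcondRank, inv_mul_le_iff₀ hN']
    refine ((c N).condRank_partition_decoding X K hB s u hu).trans (le_of_eq ?_)
    field_simp
  · refine le_of_forall_pos_le_add fun ε hε => le_of_tendsto (hlim _) ?_
    filter_upwards [hU (hrate e ε hε), hU (eventually_gt_atTop 0)] with N hN hpos
    have hN' : (0 : ℝ) < N := Nat.cast_pos.2 hpos
    refine le_trans ?_ hN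
    rw [div_eq_inv_mul]
    exact mul_le_mul_of_nonneg_left ((c N).entropicRank_partition_edge_le X K e) (by positivity)

/-- Restricting the polymatroid to sources and edges keeps all link constraints; the source
constraint is the case `β = ∅`. -/
theorem improvedRegion_subset_outerRegion [Finite S] (G : SourceNetwork V E S)
    {Y : S → Type*} [∀ s, Finite (Y s)] {L : Type*} {A : L → Type*} [Finite L] [∀ i, Finite (A i)]
    {Ω : Type*} [MeasurableSpace Ω] (μ : Measure Ω) (X : ∀ s, Ω → Y s) (K : ∀ i, Ω → A i) :
    G.improvedRegion μ X K (polymatroids _) ⊆ G.outerRegion μ X (polymatroids _) := by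
  rintro C ⟨h, hh, hsrc, hlink⟩
  refine ⟨_, IsPolymatroid.image hh (Sum.map id Sum.inl), fun α => ?_,
    LinkConstraints.comp_image hlink⟩
  have h1 := hsrc α ∅
  rw [sub_eq_zero] at h1 ⊢
  rw [Set.image_empty, Set.union_empty] at h1
  rw [Set.image_image, ← shannonEntropy_comp_injective μ (subvector X α)
    (g := fun y => (y, fun i : (∅ : Set L) => (i.2.elim : A i)))
      fun _ _ hy => (Prod.ext_iff.1 hy).1]
  exact h1.trans (congrArg (shannonEntropy μ) (funext fun ω =>
    Prod.ext rfl (Subsingleton.elim _ _)))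

end SourceNetwork
end

noncomputable section

/-! ### The example -/

theorem setoidEntropy_bot_bool : setoidEntropy (⊥ : Setoid Bool) = 1 := by
  have : ∀ t, classCard (⊥ : Setoid Bool) t = 1 := by
    intro t
    rw [classCard, Finset.card_eq_one]
    exact ⟨t, by ext u; simp [eq_comm]⟩
  simp [setoidEntropy, this]

/-- Revealing the coordinates in `γ` of a uniform bit vector reveals `|γ|` bits. -/
theorem setoidEntropy_eq_ncard {ι : Type*} [Fintype ι] [DecidableEq ι] {r : Setoid (ι → Bool)}
    {γ : Set ι} (hr : ∀ t u, r t u ↔ ∀ i ∈ γ, t i = u i) : setoidEntropy r = γ.ncard := by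
  classical
  have : r = @piSetoid ι (fun _ => Bool) fun i => if i ∈ γ then ⊥ else ⊤ := by
    ext t u
    rw [hr, Setoid.piSetoid_apply]
    refine forall_congr' fun i => ?_
    by_cases hi : i ∈ γ
    · rw [if_pos hi]
      exact ⟨fun h => h hi, fun h _ => h⟩
    · rw [if_neg hi]
      exact ⟨fun _ => trivial, fun _ h => absurd h hi⟩
  rw [this, setoidEntropy_piSetoid]
  simp_rw [apply_ite setoidEntropy, setoidEntropy_bot_bool, setoidEntropy_top]
  rw [Finset.sum_ite, Finset.sum_const_zero, add_zero, Finset.sum_const, nsmul_eq_mul, mul_one,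
    Set.ncard_eq_toFinset_card']
  congr 2
  ext i
  simp

/-- The indices of the bits which form a source. -/
def exampleBits : Fin 3 → Finset (Fin 3) := ![{0, 1}, {0, 2}, {1, 2}]

theorem exampleSources_eq_iff (s : Fin 3) (t u : Fin 3 → Bool) :
    exampleSources (fun i (t : Fin 3 → Bool) => t i) s t = exampleSources (fun i t => t i) s u ↔
      ∀ i ∈ exampleBits s, t i = u i := by
  fin_cases s <;> simp [exampleSources, exampleBits]

/-- Factors the sources through the uniform bit triple, the form which the general results require.
-/
theorem exampleSources_comp {Ω : Type*} (b : Fin 3 → Ω → Bool) :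
    exampleSources b = fun s ω =>
      exampleSources (fun i (t : Fin 3 → Bool) => t i) s fun i => b i ω := by
  funext s
  fin_cases s <;> rfl

section Law

variable {Ω : Type*} [MeasurableSpace Ω] {μ : Measure Ω} {b : Fin 3 → Ω → Bool}

theorem isUniformOn_bits (hb : ∀ i, Measurable (b i))
    (hunif : ∀ i x, μ.real (b i ⁻¹' {x}) = 1 / 2) (hindep : iIndepFun b μ) :
    IsUniformOn μ fun ω i => b i ω := by
  have hpre : ∀ t : Fin 3 → Bool, (fun ω i => b i ω) ⁻¹' {t}
      = ⋂ i ∈ Finset.univ, b i ⁻¹' {t i} := by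
    intro t
    ext ω
    simp [funext_iff]
  constructor
  · intro t
    rw [hpre]
    exact Finset.measurableSet_biInter _ fun i _ => hb i (measurableSet_singleton _)
  · intro t
    rw [hpre, measureReal_def, hindep.measure_inter_preimage_eq_mul Finset.univ
      (sets := fun i => {t i}) fun i _ => measurableSet_singleton _, ENNReal.toReal_prod]
    have : ∀ i, (μ (b i ⁻¹' {t i})).toReal = 1 / 2 := fun i => hunif i (t i)
    norm_num [this]

variable [IsProbabilityMeasure μ]

theorem shannonEntropy_exampleSources_aux (hB : IsUniformOn μ fun ω i => b i ω)
    (α β : Set (Fin 3)) :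
    shannonEntropy μ (fun ω => (subvector (exampleSources b) α ω, subvector b β ω))
      = (β ∪ ⋃ s ∈ α, exampleBits s : Set (Fin 3)).ncard := by
  rw [exampleSources_comp]
  refine (hB.shannonEntropy_comp fun t =>
    (subvector (exampleSources fun i (t : Fin 3 → Bool) => t i) α t,
      subvector (fun i (t : Fin 3 → Bool) => t i) β t)).trans (setoidEntropy_eq_ncard fun t u => ?_)
  rw [Setoid.ker_def, Prod.ext_iff, funext_iff, funext_iff, Subtype.forall, Subtype.forall]
  simp only [subvector, exampleSources_eq_iff, Set.mem_union, Set.mem_iUnion, Finset.mem_coe]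
  constructor
  · rintro ⟨h1, h2⟩ i (hi | ⟨s, hs, hi⟩)
    · exact h2 i hi
    · exact h1 s hs i hi
  · exact fun h => ⟨fun s hs i hi => h i (Or.inr ⟨s, hs, hi⟩), fun i hi => h i (Or.inl hi)⟩

theorem shannonEntropy_exampleSources (hB : IsUniformOn μ fun ω i => b i ω) (α : Set (Fin 3)) :
    shannonEntropy μ (subvector (exampleSources b) α)
      = (⋃ s ∈ α, exampleBits s : Set (Fin 3)).ncard := by
  rw [exampleSources_comp]
  refine (hB.shannonEntropy_comp
    (subvector (exampleSources fun i (t : Fin 3 → Bool) => t i) α)).trans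
      (setoidEntropy_eq_ncard fun t u => ?_)
  rw [Setoid.ker_def, funext_iff, Subtype.forall]
  simp only [subvector, exampleSources_eq_iff, Set.mem_iUnion, Finset.mem_coe]
  exact ⟨fun h1 i ⟨s, hs, hi⟩ => h1 s hs i hi, fun h s hs i hi => h i ⟨s, hs, hi⟩⟩

end Law

theorem exampleNetwork_linkConstraints_iff {Z : Type*} {src : Fin 3 → Z} {edg : Fin 4 ⊕ Fin 3 → Z}
    {h : Set Z → ℝ} {C : Fin 4 ⊕ Fin 3 → ℝ} :
    exampleNetwork.LinkConstraints src edg h C ↔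
      (∀ i, condRank h {edg (Sum.inl i)} (Set.range src) = 0) ∧
      (∀ j, condRank h {edg (Sum.inr j)} {edg (Sum.inl 0)} = 0) ∧
      (∀ j, condRank h {src j} {edg (Sum.inl j.succ), edg (Sum.inr j)} = 0) ∧
      ∀ e, h {edg e} ≤ C e := by
  have hsrc0 : exampleNetwork.sourcesAt 0 = Set.univ := by
    ext s; simp [SourceNetwork.sourcesAt, exampleNetwork]
  have hsrc : ∀ u, u ≠ 0 → exampleNetwork.sourcesAt u = ∅ := by
    intro u hu; ext s; simp [SourceNetwork.sourcesAt, exampleNetwork, hu]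
  have hedg0 : exampleNetwork.edgesInto 0 = ∅ := by
    ext f
    exact iff_of_false ((by decide : ∀ f, exampleHead f ≠ 0) f) (Set.notMem_empty f)
  have hedg1 : exampleNetwork.edgesInto 1 = {Sum.inl 0} := by
    ext f
    exact (by decide : ∀ f, exampleHead f = 1 ↔ f = Sum.inl 0) f
  have hedg : ∀ j, exampleNetwork.edgesInto (![2, 3, 4] j) = {Sum.inl j.succ, Sum.inr j} := by
    intro j
    ext f
    exact (by decide : ∀ j f, exampleHead f = ![2, 3, 4] j ↔ f = Sum.inl j.succ ∨ f = Sum.inr j)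
      j f
  have hnode : ∀ j : Fin 3, (![2, 3, 4] j : Fin 5) ≠ 0 := by decide
  have htail : ∀ i, exampleNetwork.tail (Sum.inl i) = 0 :=
    (by decide : ∀ i, exampleTail (Sum.inl i) = 0)
  have htail' : ∀ j, exampleNetwork.tail (Sum.inr j) = 1 :=
    (by decide : ∀ j, exampleTail (Sum.inr j) = 1)
  constructor
  · intro H
    refine ⟨fun i => ?_, fun j => ?_, fun j => ?_, H.capacity⟩
    · simpa [htail, hsrc0, hedg0] using H.encoding (Sum.inl i)
    · simpa [htail', hsrc, hedg1] using H.encoding (Sum.inr j)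
    · simpa [hsrc _ (hnode j), hedg, Set.image_pair] using H.decoding j (![2, 3, 4] j) rfl
  · rintro ⟨h1, h2, h3, h4⟩
    refine ⟨?_, ?_, h4⟩
    · rintro (i | j)
      · simpa [htail, hsrc0, hedg0] using h1 i
      · simpa [htail', hsrc, hedg1] using h2 j
    · rintro j u rfl
      simpa [hsrc _ (hnode j), hedg, Set.image_pair] using h3 j

/-! #### The explicit linear program -/

section LinearProgram

open ExampleVar

/-- The value on sources and auxiliary variables, in terms of the bits involved. -/
theorem ExampleLP.apply_source_aux {h : Set ExampleVar → ℝ} {C : Fin 4 → ℝ} (H : ExampleLP h C)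
    (α β : Set (Fin 3)) :
    h (s '' α ∪ k '' β) = (β ∪ ⋃ i ∈ α, exampleBits i : Set (Fin 3)).ncard := by
  have hh : IsPolymatroid h := H.polymatroid
  have hs : ∀ i, condRank h {s i} (k '' exampleBits i) = 0 := by
    intro i
    fin_cases i
    · simpa [exampleBits, Set.image_pair] using H.source_of_aux₁
    · simpa [exampleBits, Set.image_pair] using H.source_of_aux₂
    · simpa [exampleBits, Set.image_pair] using H.source_of_aux₃
  have heq : ∀ i, h (k '' exampleBits i) = h {s i} := by
    intro i
    fin_cases i
    · simpa [exampleBits, Set.image_pair] using H.aux_pair₁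
    · simpa [exampleBits, Set.image_pair] using H.aux_pair₂
    · simpa [exampleBits, Set.image_pair] using H.aux_pair₃
  -- Since a source and its pair of bits have equal rank, dependence in one direction gives the
  -- other. Sources and bit pairs are thus interchangeable.
  have hk : ∀ i, condRank h (k '' exampleBits i) {s i} = 0 := by
    intro i
    rw [condRank, Set.union_comm, ← heq]
    exact hs i
  rw [← H.aux]
  refine le_antisymm (le_of_condRank_eq_zero hh ?_) (le_of_condRank_eq_zero hh ?_)
  · refine condRank_union_eq_zero hh ?_ (condRank_eq_zero_of_subset h
      (Set.image_mono Set.subset_union_left))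
    refine condRank_eq_zero_of_forall hh (Set.toFinite _) ?_
    rintro _ ⟨i, hi, rfl⟩
    exact condRank_eq_zero_mono hh (Set.image_mono
      ((Set.subset_biUnion_of_mem (u := fun i => (exampleBits i : Set (Fin 3))) hi).trans
        Set.subset_union_right)) (hs i)
  · refine condRank_eq_zero_of_forall hh (Set.toFinite _) ?_
    rintro _ ⟨j, hj | hj, rfl⟩
    · exact condRank_eq_zero_of_subset h (by simp [hj])
    · obtain ⟨i, hi, hij⟩ := Set.mem_iUnion₂.1 hj
      refine condRank_eq_zero_trans hh (condRank_eq_zero_of_subset h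
        (Set.singleton_subset_iff.2 (Set.mem_image_of_mem k hij)))
        (condRank_eq_zero_mono hh ?_ (hk i))
      simp [hi]

theorem ExampleLP.false_of_capacity_one {h : Set ExampleVar → ℝ}
    (H : ExampleLP h fun _ => 1) : False := by
  have hh : IsPolymatroid h := H.polymatroid
  have hpair : ∀ e', h {e 0, e e'} ≤ h {e 0} + h {e e'} := fun e' => by
    have := hh.add_le_add_of_subset (α := {e 0}) (β := {e e'}) (γ := ∅) (δ := {e 0, e e'})
      (Set.empty_subset _) (Set.empty_subset _) subset_rfl
    rwa [hh.empty, zero_add] at this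
  -- The two links have joint rank at most 2, the rank of the source they determine, so nothing is
  -- left over and the source determines `e 0`.
  have hdec : ∀ j e', condRank h {s j} {e 0, e e'} = 0 → condRank h {e 0} {s j} = 0 := by
    intro j e' hj
    rw [condRank_eq_zero_iff_le hh] at hj ⊢
    have h1 := hh.mono ({s j} ∪ {e 0, e e'}) ({e 0} ∪ {s j}) (by
      rw [Set.union_comm]
      exact Set.union_subset_union_right _ (by simp))
    have := hpair e'
    have := H.capacity 0
    have := H.capacity e'
    have := H.source j
    linarith
  have h01 := condRank_eq_zero_trans hh (hdec 0 1 H.decoding₁) H.source_of_aux₁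
  have h02 := condRank_eq_zero_trans hh (hdec 1 2 H.decoding₂) H.source_of_aux₂
  have h12 := condRank_eq_zero_trans hh (hdec 2 3 H.decoding₃) H.source_of_aux₃
  rw [condRank_eq_zero_iff_le hh] at h01 h02 h12
  have e01 := H.aux_pair₁.trans (H.source 0)
  have e02 := H.aux_pair₂.trans (H.source 1)
  have e12 := H.aux_pair₃.trans (H.source 2)
  have e012 : h {k 0, k 1, k 2} = 3 := by
    have := H.aux {0, 1, 2}
    rw [show ({0, 1, 2} : Set (Fin 3)).ncard = 3 by
      rw [Set.ncard_eq_toFinset_card']; rfl] at this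
    simpa [Set.image_insert_eq] using this
  -- Both sets on the right have rank at most 2 and the three bits have rank 3, so `{e 0, k 0}` has
  -- rank at most 1. Likewise `a1` bounds `{e 0, k 1}`, and `a2` then gives `h {e 0} ≤ 1 + 1 - 2 =
  -- 0`.
  have a0 := hh.add_le_add_of_subset (α := {e 0} ∪ {k 0, k 1}) (β := {e 0} ∪ {k 0, k 2})
    (γ := {e 0, k 0}) (δ := {k 0, k 1, k 2})
    (by intro x; simp; tauto) (by intro x; simp; tauto) (by intro x; simp; tauto)
  have a1 := hh.add_le_add_of_subset (α := {e 0} ∪ {k 0, k 1}) (β := {e 0} ∪ {k 1, k 2})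
    (γ := {e 0, k 1}) (δ := {k 0, k 1, k 2})
    (by intro x; simp; tauto) (by intro x; simp; tauto) (by intro x; simp; tauto)
  have a2 := hh.add_le_add_of_subset (α := {e 0, k 0}) (β := {e 0, k 1})
    (γ := {e 0}) (δ := {k 0, k 1})
    (by intro x; simp; tauto) (by intro x; simp; tauto) (by intro x; simp; tauto)
  have d := le_of_condRank_eq_zero hh H.decoding₁
  have := H.source 0
  have := hpair 1
  have := H.capacity 1
  linarith

/-- All equations among sources and bits are instances of the single formula `hval`, reduced to
finite cardinality checks. -/
theorem ExampleLP.of_apply_source_aux {h : Set ExampleVar → ℝ} {C : Fin 4 → ℝ}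
    (hh : IsPolymatroid h)
    (hval : ∀ α β : Set (Fin 3),
      h (s '' α ∪ k '' β) = (β ∪ ⋃ i ∈ α, exampleBits i : Set (Fin 3)).ncard)
    (henc : ∀ i, condRank h {e i} {s 0, s 1, s 2} = 0)
    (hdec : ∀ j : Fin 3, condRank h {s j} {e 0, e j.succ} = 0)
    (hcap : ∀ i, h {e i} ≤ C i) : ExampleLP h C := by
  have hfin : ∀ (α β : Finset (Fin 3)) (n : ℕ), (β ∪ α.biUnion exampleBits).card = n →
      h (s '' α ∪ k '' β) = n := by
    rintro α β n rfl
    rw [hval, ← Set.ncard_coe_finset]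
    simp
  have hs : ∀ i, h {s i} = 2 := fun i => by
    simpa using hfin {i} ∅ 2 (by revert i; decide)
  have h01 : h {k 0, k 1} = 2 := by
    simpa [Set.image_insert_eq] using hfin ∅ {0, 1} 2 (by decide)
  have h02 : h {k 0, k 2} = 2 := by
    simpa [Set.image_insert_eq] using hfin ∅ {0, 2} 2 (by decide)
  have h12 : h {k 1, k 2} = 2 := by
    simpa [Set.image_insert_eq] using hfin ∅ {1, 2} 2 (by decide)
  refine ⟨hh, hs, fun i j hij => ?_, fun α => ?_, ?_, ?_, ?_, h01.trans (hs 0).symm,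
    h02.trans (hs 1).symm, h12.trans (hs 2).symm, henc, hdec 0, hdec 1, hdec 2, hcap⟩
  · simpa [Set.image_insert_eq] using hfin {i, j} ∅ 3 (by revert i j; decide)
  · simpa using hval ∅ α
  · rw [condRank, h01, sub_eq_zero]
    simpa [Set.image_insert_eq] using hfin {0} {0, 1} 2 (by decide)
  · rw [condRank, h02, sub_eq_zero]
    simpa [Set.image_insert_eq] using hfin {1} {0, 2} 2 (by decide)
  · rw [condRank, h12, sub_eq_zero]
    simpa [Set.image_insert_eq] using hfin {2} {1, 2} 2 (by decide)

/-- The variables of the linear program among those of the improved bound. -/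
def exampleVarEmb : ExampleVar → Fin 3 ⊕ (Fin 4 ⊕ Fin 3) ⊕ Fin 3
  | s i => Sum.inl i
  | e i => Sum.inr (Sum.inl (Sum.inl i))
  | k i => Sum.inr (Sum.inr i)

/-- The variable of the linear program which stands for a variable of the improved bound: every
relay edge carries the message of the first link. -/
def exampleVarProj : Fin 3 ⊕ (Fin 4 ⊕ Fin 3) ⊕ Fin 3 → ExampleVar
  | Sum.inl i => s i
  | Sum.inr (Sum.inl (Sum.inl i)) => e i
  | Sum.inr (Sum.inl (Sum.inr _)) => e 0
  | Sum.inr (Sum.inr i) => k i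

variable {Ω : Type*} [MeasurableSpace Ω] {μ : Measure Ω} {b : Fin 3 → Ω → Bool}
  {C : Fin 4 → ℝ} {D : Fin 3 → ℝ}

theorem exists_exampleLP_of_mem_improvedRegion [IsProbabilityMeasure μ]
    (hB : IsUniformOn μ fun ω i => b i ω)
    (H : Sum.elim C D ∈
      exampleNetwork.improvedRegion μ (exampleSources b) b (polymatroids _)) :
    ∃ h, ExampleLP h C := by
  obtain ⟨h, hh, hval, hlink⟩ := H
  replace hh : IsPolymatroid h := hh
  rw [exampleNetwork_linkConstraints_iff] at hlink
  obtain ⟨henc, hrelay, hdec, hcap⟩ := hlink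
  have hP := hh.image exampleVarEmb
  have hset : ∀ α β : Set (Fin 3), h (exampleVarEmb '' (s '' α ∪ k '' β))
      = (β ∪ ⋃ i ∈ α, exampleBits i : Set (Fin 3)).ncard := by
    intro α β
    rw [← shannonEntropy_exampleSources_aux hB, ← sub_eq_zero, Set.image_union, Set.image_image,
      Set.image_image]
    exact hval α β
  have hrange : exampleVarEmb '' {s 0, s 1, s 2} = Set.range Sum.inl := by
    ext x
    simp [Set.image_insert_eq, exampleVarEmb, Fin.exists_fin_succ, eq_comm]
  have hdec' : ∀ j : Fin 3, condRank (fun β => h (exampleVarEmb '' β)) {s j} {e 0, e j.succ}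
      = 0 := by
    intro j
    -- A relay message is a function of the first link, so the relay can be replaced by that link in
    -- the decoding constraint.
    have h1 : condRank h {Sum.inr (Sum.inl (Sum.inl j.succ)), Sum.inr (Sum.inl (Sum.inr j))}
        {Sum.inr (Sum.inl (Sum.inl 0)), Sum.inr (Sum.inl (Sum.inl j.succ))} = 0 := by
      rw [Set.insert_eq]
      exact condRank_union_eq_zero hh (condRank_eq_zero_of_subset h (by simp))
        (condRank_eq_zero_mono hh (by simp) (hrelay j))
    simpa [condRank, Set.image_insert_eq, exampleVarEmb] using
      condRank_eq_zero_trans hh (hdec j) h1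
  refine ⟨fun β => h (exampleVarEmb '' β), .of_apply_source_aux hP hset (fun i => ?_) hdec'
    fun i => ?_⟩
  · simp only [condRank, Set.image_union, hrange, Set.image_singleton]
    exact henc i
  · simp only [Set.image_singleton]
    exact hcap (Sum.inl i)

/-- Pulling back along `exampleVarProj` lets each relay repeat the first link; this is where the
relay capacities must be at least `C 0`. -/
theorem mem_improvedRegion_of_exampleLP [IsProbabilityMeasure μ]
    (hB : IsUniformOn μ fun ω i => b i ω) (hD : ∀ j, C 0 ≤ D j) {h : Set ExampleVar → ℝ}
    (H : ExampleLP h C) :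
    Sum.elim C D ∈
      exampleNetwork.improvedRegion μ (exampleSources b) b (polymatroids _) := by
  have hh : IsPolymatroid h := H.polymatroid
  refine ⟨fun β => h (exampleVarProj '' β), hh.image _, fun α β => ?_,
    exampleNetwork_linkConstraints_iff.2 ⟨fun i => ?_, fun j => ?_, fun j => ?_, ?_⟩⟩
  · rw [sub_eq_zero, shannonEntropy_exampleSources_aux hB, ← H.apply_source_aux]
    simp only [Set.image_union, Set.image_image]
    rfl
  · have hrange : exampleVarProj '' Set.range Sum.inl = {s 0, s 1, s 2} := by
      ext x
      simp [exampleVarProj, Fin.exists_fin_succ, eq_comm]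
    simp only [condRank, Set.image_union, Set.image_singleton, hrange]
    exact H.encoding i
  · simp only [condRank, Set.image_union, Set.image_singleton]
    exact condRank_eq_zero_of_subset h subset_rfl
  · simp only [condRank, Set.image_union, Set.image_singleton, Set.image_insert_eq]
    rw [Set.pair_comm]
    fin_cases j
    exacts [H.decoding₁, H.decoding₂, H.decoding₃]
  · rintro (i | j)
    · simpa [exampleVarProj] using H.capacity i
    · simpa [exampleVarProj] using (H.capacity 0).trans (hD j)

theorem not_mem_improvedRegion [IsProbabilityMeasure μ]
    (hB : IsUniformOn μ fun ω i => b i ω) (D : Fin 3 → ℝ) :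
    Sum.elim (fun _ : Fin 4 => (1 : ℝ)) D ∉
      exampleNetwork.improvedRegion μ (exampleSources b) b (polymatroids _) := fun hmem =>
  let ⟨_, H⟩ := exists_exampleLP_of_mem_improvedRegion hB hmem
  H.false_of_capacity_one

end LinearProgram

/-- Subsets of a set of four elements in general position in a space of dimension three: the
element `0` stands for a bit shared by all sources and carried by the first link. -/
def exampleGeneric : Fin 3 ⊕ Fin 4 ⊕ Fin 3 → Finset (Fin 4)
  | Sum.inl i => {0, i.succ}
  | Sum.inr (Sum.inl i) => {i}
  | Sum.inr (Sum.inr _) => {0}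

/-- One source covers two of the four points, two cover three, and all three cover four, truncated
to rank 3: exactly the source entropies. Every edge is a single point of rank 1. -/
theorem mem_outerRegion {Ω : Type*} [MeasurableSpace Ω] {μ : Measure Ω} [IsProbabilityMeasure μ]
    {b : Fin 3 → Ω → Bool} (hB : IsUniformOn μ fun ω i => b i ω) {D : Fin 3 → ℝ}
    (hD : ∀ j, 1 ≤ D j) :
    Sum.elim (fun _ : Fin 4 => (1 : ℝ)) D ∈
      exampleNetwork.outerRegion μ (exampleSources b) (polymatroids _) := by
  have hh := (isPolymatroid_min_ncard (W := Fin 4) 3).biUnion fun z => (exampleGeneric z : Set _)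
  have hfin : ∀ α : Finset (Fin 3 ⊕ Fin 4 ⊕ Fin 3),
      (⋃ z ∈ (α : Set (Fin 3 ⊕ Fin 4 ⊕ Fin 3)), (exampleGeneric z : Set (Fin 4))).ncard
        = (α.biUnion exampleGeneric).card := by
    intro α
    rw [← Set.ncard_coe_finset]
    simp
  refine ⟨_, hh, fun α => ?_,
    exampleNetwork_linkConstraints_iff.2 ⟨fun i => ?_, fun j => ?_, fun j => ?_, ?_⟩⟩
  · classical
    obtain ⟨α, rfl⟩ : ∃ β : Finset (Fin 3), (β : Set (Fin 3)) = α := ⟨α.toFinset, by simp⟩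
    have h1 : (⋃ i ∈ (α : Set (Fin 3)), exampleBits i : Set (Fin 3)).ncard
        = (α.biUnion exampleBits).card := by
      rw [← Set.ncard_coe_finset]
      simp
    have h2 := hfin (α.image Sum.inl)
    rw [Finset.coe_image] at h2
    rw [sub_eq_zero, shannonEntropy_exampleSources hB, h1, h2, Nat.cast_inj]
    exact (by decide : ∀ α : Finset (Fin 3),
      min 3 ((α.image Sum.inl).biUnion exampleGeneric).card = (α.biUnion exampleBits).card) α
  · have h1 := hfin (Finset.univ.image Sum.inl)
    have h2 := hfin ({Sum.inr (Sum.inl i)} ∪ Finset.univ.image Sum.inl)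
    rw [Finset.coe_union, Finset.coe_image, Finset.coe_univ, Set.image_univ,
      Finset.coe_singleton] at h2
    rw [Finset.coe_image, Finset.coe_univ, Set.image_univ] at h1
    rw [condRank, h1, h2, sub_eq_zero, Nat.cast_inj]
    exact (by decide : ∀ i,
      min 3 (({Sum.inr (Sum.inl i)} ∪ Finset.univ.image Sum.inl).biUnion exampleGeneric).card
        = min 3 ((Finset.univ.image Sum.inl).biUnion exampleGeneric).card) i
  · rw [condRank, Set.biUnion_union]
    simp [exampleGeneric]
  -- The direct link supplies the point `j.succ` and the relay the point `0`, which together are the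
  -- points of source `j`.
  · rw [condRank, Set.biUnion_union, Set.biUnion_pair, Set.biUnion_singleton]
    rw [Set.union_eq_right.2 (by simp [exampleGeneric]), sub_self]
  · rintro (i | j)
    · simp [exampleGeneric]
    · simpa [exampleGeneric] using hD j

theorem mainTheorem7 {Ω : Type*} [MeasurableSpace Ω] (μ : Measure Ω) [IsProbabilityMeasure μ]
    (b : Fin 3 → Ω → Bool) (hb : ∀ i, Measurable (b i))
    (hunif : ∀ i x, μ.real (b i ⁻¹' {x}) = 1 / 2) (hindep : iIndepFun b μ) :
    -- the improved region of the network is given by the explicit linear program, provided that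
    -- the relay edges can carry the message of the first link
    (∀ (C : Fin 4 → ℝ) (D : Fin 3 → ℝ), (∀ j, C 0 ≤ D j) →
      (Sum.elim C D ∈ exampleNetwork.improvedRegion μ (exampleSources b) b (polymatroids _) ↔
        ∃ h, ExampleLP h C)) ∧
    -- it is an outer bound for the achievable region
    exampleNetwork.achievableRegion μ (exampleSources b) ⊆
      exampleNetwork.improvedRegion μ (exampleSources b) b (polymatroids _) ∧
    -- the tuple (1, 1, 1, 1) lies in the basic bound
    (∀ D : Fin 3 → ℝ, (∀ j, 1 ≤ D j) →
      Sum.elim (fun _ : Fin 4 => (1 : ℝ)) D ∈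
        exampleNetwork.outerRegion μ (exampleSources b) (polymatroids _)) ∧
    -- it is excluded by the improved bound, and not achievable, whatever the relay capacities are
    (∀ D : Fin 3 → ℝ, Sum.elim (fun _ : Fin 4 => (1 : ℝ)) D ∉
      exampleNetwork.improvedRegion μ (exampleSources b) b (polymatroids _)) ∧
    (∀ D : Fin 3 → ℝ, Sum.elim (fun _ : Fin 4 => (1 : ℝ)) D ∉
      exampleNetwork.achievableRegion μ (exampleSources b)) ∧
    -- the improved bound is strictly tighter: for all seven edges, and for the four link
    -- capacities when the relay capacities are fixed and at least 1
    exampleNetwork.improvedRegion μ (exampleSources b) b (polymatroids _) ⊂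
      exampleNetwork.outerRegion μ (exampleSources b) (polymatroids _) ∧
    (∀ D : Fin 3 → ℝ, (∀ j, 1 ≤ D j) →
      {C : Fin 4 → ℝ | Sum.elim C D ∈
        exampleNetwork.improvedRegion μ (exampleSources b) b (polymatroids _)} ⊂
      {C : Fin 4 → ℝ | Sum.elim C D ∈
        exampleNetwork.outerRegion μ (exampleSources b) (polymatroids _)}) := by
  have hB := isUniformOn_bits hb hunif hindep
  have hout : exampleNetwork.achievableRegion μ (exampleSources b) ⊆
      exampleNetwork.improvedRegion μ (exampleSources b) b (polymatroids _) := by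
    rw [exampleSources_comp]
    exact exampleNetwork.achievableRegion_subset_improvedRegion hB _ fun i t => t i
  have hsub := exampleNetwork.improvedRegion_subset_outerRegion μ (exampleSources b) b
  refine ⟨fun C D hD => ⟨exists_exampleLP_of_mem_improvedRegion hB,
      fun ⟨h, H⟩ => mem_improvedRegion_of_exampleLP hB hD H⟩,
    hout, fun D hD => mem_outerRegion hB hD, not_mem_improvedRegion hB,
    fun D hD => not_mem_improvedRegion hB D (hout hD), ?_, fun D hD => ?_⟩
  · exact Set.ssubset_iff_exists.2 ⟨hsub, _, mem_outerRegion hB (D := fun _ => 1) fun _ => le_rfl,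
      not_mem_improvedRegion hB _⟩
  · exact Set.ssubset_iff_exists.2 ⟨fun C hC => hsub hC, _, mem_outerRegion hB hD,
      not_mem_improvedRegion hB D⟩

end
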